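/- A PIR code for $N\ge 1$ servers and $K\ge 1$ messages consists of the following. Messages $W_0,\dots,W_{K-1}$, each a vector in $\mathcal X^L$ over a finite alphabet $\mathcal X$, are replicated on all servers, and are independent and uniformly distributed on $\mathcal X^L$. A random key $\mathsf F$, independent of the messages, is uniform on a finite nonempty set $\mathcal F$. To retrieve $W_k$, the user sends to server $n$ the query $Q_n^{[k]}=\phi_n(k,\mathsf F)$, which lies in a finite set $\mathcal Q_n$. On query $q\in\mathcal Q_n$, server $n$ returns $\varphi_n(q,W_{0:K-1})\in\mathcal Y^{\ell_n(q)}$, where $\mathcal Y$ is a finite alphabet and the length $\ell_n(q)\ge 0$ depends only on $q$. From the $N$ answers, $k$ and $\mathsf F$, the user always recovers $W_k$ exactly (correctness), and for every $n$ and every $q\in\mathcal Q_n$ the probability $\Pr(Q_n^{[k]}=q)$ does not depend on $k$ (privacy). The code is decomposable if $\mathcal Y$ is a finite abelian group and, for all $n$ and $q\in\mathcal Q_n$, each coordinate of $\varphi_n(q,W_{0:K-1})$ is a sum $\sum_{k=0}^{K-1} g_k(W_k)$ in $\mathcal Y$ with functions $g_k:\mathcal X^L\to\mathcal Y$ (depending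 on $n$, $q$ and the coordinate). Its retrieval rate is $$R=\frac{L\log_2|\mathcal X|}{\log_2|\mathcal Y|\,\sum_{n=0}^{N-1}\mathbb E[\ell_n(Q_n^{[k]})]},$$ which by privacy does not depend on $k$, and the code is capacity-achieving if $R=\bigl(1+\frac1N+\dots+\frac1{N^{K-1}}\bigr)^{-1}$. Its upload cost is $\sum_{n=0}^{N-1}\log_2|\mathcal Q_n|$. Theorem. The upload cost of every capacity-achieving decomposable PIR code is at least $N(K-1)\log_2 N$. Moreover, $|\mathcal Q_n|\ge N^{K-1}$ for every server $n$. -/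

import Mathlib

/-- An `N`-server private information retrieval code for `K` messages, each consisting of `L`
symbols from the finite alphabet `X`.  The answers are variable-length vectors over the finite
alphabet `Y`, the random key is uniformly distributed on the finite nonempty set `F`, and `Q n` is
the finite set of possible queries to server `n`. -/
structure PIRCode (N K L : ℕ) (X Y F : Type*) (Q : Fin N → Type*)
    [Fintype X] [Fintype Y] [Fintype F] [Nonempty F] [∀ n, Fintype (Q n)] where
  /-- the query sent to server `n` when message `k` is requested and the key is `f` -/
  query : (n : Fin N) → Fin K → F → Q n
  /-- the length of the answer of server `n`, a function of the query only -/
  len : (n : Fin N) → Q n → ℕ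
  /-- the answer of server `n` to a query, as a function of all the messages -/
  answer : (n : Fin N) → (q : Q n) → (Fin K → Fin L → X) → (Fin (len n q) → Y)
  /-- the reconstruction function: message index, key and received answers to a message -/
  reconstruct : (k : Fin K) → (f : F) → ((n : Fin N) → Fin (len n (query n k f)) → Y) →
    (Fin L → X)
  /-- the requested message is always reconstructed -/
  correct : ∀ (k : Fin K) (f : F) (W : Fin K → Fin L → X),
    reconstruct k f (fun n => answer n (query n k f) W) = W k
  /-- the law of the query to each single server does not depend on the requested message;
  for a key uniform on `F`, `Pr (Q n = q)` is the proportion of keys that produce `q` -/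
  privacy : ∀ (k k' : Fin K) (n : Fin N) (q : Q n),
    (Nat.card {f : F // query n k f = q} : ℝ) / Fintype.card F =
      (Nat.card {f : F // query n k' f = q} : ℝ) / Fintype.card F

namespace PIRCode

variable {N K L : ℕ} {X Y F : Type*} {Q : Fin N → Type*}
  [Fintype X] [Fintype Y] [Fintype F] [Nonempty F] [∀ n, Fintype (Q n)]

/-- The probability that the query to server `n` is `q` when message `k` is requested. -/
noncomputable def queryProb (c : PIRCode N K L X Y F Q) (k : Fin K) (n : Fin N) (q : Q n) : ℝ :=
  (Nat.card {f : F // c.query n k f = q} : ℝ) / Fintype.card F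

/-- The expected answer length of server `n` when message `k` is requested. -/
noncomputable def expectedLength (c : PIRCode N K L X Y F Q) (k : Fin K) (n : Fin N) : ℝ :=
  ∑ q : Q n, c.queryProb k n q * (c.len n q : ℝ)

/-- The retrieval rate: bits of message per expected bit of downloaded data. -/
noncomputable def rate (c : PIRCode N K L X Y F Q) (k : Fin K) : ℝ :=
  ((L : ℝ) * Real.logb 2 (Fintype.card X)) /
    (Real.logb 2 (Fintype.card Y) * ∑ n : Fin N, c.expectedLength k n)

/-- By privacy, the retrieval rate does not depend on the requested message. -/
theorem rate_eq (c : PIRCode N K L X Y F Q) (k k' : Fin K) : c.rate k = c.rate k' := by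
  have h : ∀ n q, c.queryProb k n q = c.queryProb k' n q := fun n q => c.privacy k k' n q
  simp only [rate, expectedLength, h]

/-- The upload cost in bits. -/
noncomputable def uploadCost (_c : PIRCode N K L X Y F Q) : ℝ :=
  ∑ n : Fin N, Real.logb 2 (Fintype.card (Q n))

/-- The PIR capacity `(1 + 1/N + ⋯ + 1/N^(K-1))⁻¹`. -/
noncomputable def capacity (N K : ℕ) : ℝ :=
  (∑ i ∈ Finset.range K, (1 / (N : ℝ)) ^ i)⁻¹

/-- The retrieval rate equals the PIR capacity. -/
def IsCapacityAchieving (c : PIRCode N K L X Y F Q) : Prop :=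
  ∀ k : Fin K, c.rate k = capacity N K

/-- Every answer symbol is a sum, in the abelian group `Y`, of functions of the individual
messages. -/
def IsDecomposable [AddCommGroup Y] (c : PIRCode N K L X Y F Q) : Prop :=
  ∀ (n : Fin N) (q : Q n), ∃ g : Fin (c.len n q) → Fin K → (Fin L → X) → Y,
    ∀ (W : Fin K → Fin L → X) (i : Fin (c.len n q)),
      c.answer n q W i = ∑ k : Fin K, g i k (W k)

end PIRCode

/-!
The converse of the capacity theorem is followed on every set `T` of messages, and the equality
case is read off. For a decomposable code, conditioning an answer on the messages outside `T`
amounts to keeping only the contribution of `T`, so it suffices to use entropies of functions on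
the uniform space of message tuples. Let `M = L log |X|`, let `h_n(T)` be the entropy of the
contribution of `T` to the answer of server `n`, and let `J(T)` be the joint entropy over all
servers. If `k ∈ T` is requested, then `h_n(T \ k) ≤ J(T \ k)` for each `n` and
`M + J(T \ k) ≤ J(T) ≤ ∑ n, h_n(T)` (`add_jointEntropy_erase_le`). By privacy the average of
`∑ n, h_n(T)` over the keys does not depend on the request; these averages therefore satisfy a
recursion in `|T|` that gives the capacity (`le_download`). Attaining the capacity forces equality
for all `T` (`download_le`) and hence for every single key:
`∑ n, h_n(T) = M + J(T \ k)` and `h_n(T \ k) = J(T \ k)`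
(`sum_partEntropy_eq_add_jointEntropy`, `partEntropy_eq_jointEntropy`).

Consequently, let the signature of a query assign to each message `j` the partition of the message
tuples induced by the contribution of `j`. When `k` is requested, the signatures of the `N` queries
agree at each `j ≠ k` (`signature_eq_of_ne`) and are pairwise different at `k`, provided that they
are nontrivial at some `z ≠ k` (`signature_requested_ne`). By privacy, a query used for one message
is also used for every other. Starting from a query with a nontrivial signature at `z` and
requesting all the other messages one after the other, each step multiplies the number of
signatures by `N` and keeps the value at `z`; this yields `N ^ (K - 1)` signatures that differ away
from `z` (`exists_signatures`). Requesting `z` moves all of them to any given server without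
changing them away from `z`.
-/

namespace PIRCode

/-! ### Entropy of functions on a finite uniform space -/

section Entropy

variable {Ω α β : Type*} [Fintype Ω]

open Classical in
/-- The fibre of `f` through `ω`. -/
noncomputable def fiber (f : Ω → α) (ω : Ω) : Finset Ω := {ω' | f ω' = f ω}

theorem mem_fiber {f : Ω → α} {ω ω' : Ω} : ω' ∈ fiber f ω ↔ f ω' = f ω := by
  simp [fiber]

theorem fiber_eq_iff {f : Ω → α} {ω ω' : Ω} : fiber f ω = fiber f ω' ↔ f ω = f ω' := by
  refine ⟨fun h => mem_fiber.1 (h ▸ mem_fiber.2 rfl), fun h => ?_⟩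
  ext x
  rw [mem_fiber, mem_fiber, h]

theorem card_fiber_pos (f : Ω → α) (ω : Ω) : 0 < ((fiber f ω).card : ℝ) := by
  exact_mod_cast Finset.card_pos.2 ⟨ω, mem_fiber.2 rfl⟩

/-- The Shannon entropy, in nats, of `f ω` for `ω` uniform on `Ω`, written as the mean of
`log (|Ω| / |f⁻¹(f ω)|)`. This form does not need the codomain of `f` to be finite. -/
noncomputable def entropy (f : Ω → α) : ℝ :=
  (∑ ω, (Real.log (Fintype.card Ω) - Real.log (fiber f ω).card)) / Fintype.card Ω

theorem entropy_mono {f : Ω → α} {g : Ω → β} (h : ∀ ω ω', g ω = g ω' → f ω = f ω') :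
    entropy f ≤ entropy g := by
  unfold entropy
  gcongr with ω
  · exact card_fiber_pos g ω
  · intro x hx
    exact mem_fiber.2 (h _ _ (mem_fiber.1 hx))

theorem entropy_congr {f : Ω → α} {g : Ω → β} (h : ∀ ω ω', g ω = g ω' ↔ f ω = f ω') :
    entropy f = entropy g :=
  le_antisymm (entropy_mono fun _ _ => (h _ _).1) (entropy_mono fun _ _ => (h _ _).2)

/-- A function of `g` with the entropy of `g` determines `g`. -/
theorem eq_of_entropy_eq {f : Ω → α} {g : Ω → β} (h : ∀ ω ω', g ω = g ω' → f ω = f ω')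
    (he : entropy f = entropy g) {ω ω' : Ω} (hf : f ω = f ω') : g ω = g ω' := by
  have hsub : ∀ x, fiber g x ⊆ fiber f x := fun x y hy => mem_fiber.2 (h _ _ (mem_fiber.1 hy))
  have : Nonempty Ω := ⟨ω⟩
  have hc : (Fintype.card Ω : ℝ) ≠ 0 := by exact_mod_cast Fintype.card_ne_zero
  unfold entropy at he
  rw [div_left_inj' hc, Finset.sum_eq_sum_iff_of_le] at he
  · have h1 := he ω' (Finset.mem_univ _)
    have h2 : ((fiber g ω').card : ℝ) = (fiber f ω').card :=
      Real.log_injOn_pos (card_fiber_pos g ω') (card_fiber_pos f ω') (by linarith)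
    have h3 : fiber g ω' = fiber f ω' :=
      Finset.eq_of_subset_of_card_le (hsub ω') (by exact_mod_cast h2.ge)
    exact mem_fiber.1 (h3 ▸ mem_fiber.2 hf)
  · intro x _
    gcongr
    · exact card_fiber_pos g x
    · exact hsub x

theorem entropy_const [Nonempty Ω] {f : Ω → α} (h : ∀ ω ω', f ω = f ω') : entropy f = 0 := by
  have : ∀ ω, fiber f ω = Finset.univ := fun ω =>
    Finset.eq_univ_iff_forall.2 fun x => mem_fiber.2 (h _ _)
  simp [entropy, this]

theorem entropy_nonneg [Nonempty Ω] (f : Ω → α) : 0 ≤ entropy f := by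
  rw [← entropy_const (Ω := Ω) (f := fun _ => ()) (fun _ _ => rfl)]
  exact entropy_mono fun _ _ _ => rfl

theorem eq_of_entropy_eq_zero {f : Ω → α} (h : entropy f = 0) (ω ω' : Ω) : f ω = f ω' := by
  have : Nonempty Ω := ⟨ω⟩
  refine eq_of_entropy_eq (f := fun _ : Ω => ()) (fun _ _ _ => rfl) ?_ rfl
  rw [h, entropy_const fun _ _ => rfl]

/-- Gibbs' inequality: coding `f` with a subprobability `u` costs at least the entropy of `f`. -/
theorem entropy_le_of_sum_le_one [Nonempty Ω] [DecidableEq α]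
    (f : Ω → α) (u : α → ℝ) (hu : ∀ ω, 0 < u (f ω))
    (hsum : ∑ a ∈ Finset.univ.image f, u a ≤ 1) :
    entropy f ≤ (∑ ω, -Real.log (u (f ω))) / Fintype.card Ω := by
  have hc : 0 < (Fintype.card Ω : ℝ) := by exact_mod_cast Fintype.card_pos
  unfold entropy
  rw [div_le_div_iff_of_pos_right hc, ← sub_nonpos, ← Finset.sum_sub_distrib]
  have h1 : ∀ ω, Real.log (Fintype.card Ω) - Real.log (fiber f ω).card - -Real.log (u (f ω)) ≤
      Fintype.card Ω * (u (f ω) / (fiber f ω).card) - 1 := by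
    intro ω
    have hF := card_fiber_pos f ω
    have := Real.log_le_sub_one_of_pos (mul_pos hc (div_pos (hu ω) hF))
    rw [Real.log_mul hc.ne' (div_pos (hu ω) hF).ne', Real.log_div (hu ω).ne' hF.ne'] at this
    linarith
  have h2 : ∑ ω, u (f ω) / (fiber f ω).card = ∑ a ∈ Finset.univ.image f, u a := by
    rw [← Finset.sum_fiberwise_of_maps_to (g := f) (t := Finset.univ.image f)
      (fun ω _ => Finset.mem_image_of_mem _ (Finset.mem_univ ω))]
    refine Finset.sum_congr rfl fun a ha => ?_
    obtain ⟨ω, -, rfl⟩ := Finset.mem_image.1 ha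
    have : ∀ x ∈ (Finset.univ.filter fun x => f x = f ω),
        u (f x) / ((fiber f x).card : ℝ) = u (f ω) / (fiber f ω).card := by
      intro x hx
      have hx := (Finset.mem_filter.1 hx).2
      rw [fiber_eq_iff.2 hx, hx]
    rw [Finset.sum_congr rfl this, Finset.sum_const, nsmul_eq_mul]
    have hF := card_fiber_pos f ω
    have e : (Finset.univ.filter fun x => f x = f ω) = fiber f ω := by
      ext x; simp [mem_fiber]
    rw [e]
    field_simp
  refine (Finset.sum_le_sum fun ω _ => h1 ω).trans ?_
  rw [Finset.sum_sub_distrib, ← Finset.mul_sum, h2]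
  simp only [Finset.sum_const, Finset.card_univ, nsmul_eq_mul, mul_one]
  nlinarith

theorem entropy_le_log_card [Nonempty Ω] [Fintype α] (f : Ω → α) :
    entropy f ≤ Real.log (Fintype.card α) := by
  classical
  have : Nonempty α := Nonempty.map f inferInstance
  have hα : 0 < (Fintype.card α : ℝ) := by exact_mod_cast Fintype.card_pos
  have hc : 0 < (Fintype.card Ω : ℝ) := by exact_mod_cast Fintype.card_pos
  refine (entropy_le_of_sum_le_one f (fun _ => (Fintype.card α : ℝ)⁻¹)
    (fun _ => inv_pos.2 hα) ?_).trans ?_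
  · rw [Finset.sum_const, nsmul_eq_mul, ← div_eq_mul_inv, div_le_one hα]
    exact_mod_cast Finset.card_le_univ _
  · simp [Real.log_inv, hc.ne']

/-- Subadditivity of entropy. -/
theorem entropy_pi_le [Nonempty Ω] {ι : Type*} [Fintype ι] {γ : ι → Type*}
    (f : ∀ i, Ω → γ i) : entropy (fun ω i => f i ω) ≤ ∑ i, entropy (f i) := by
  classical
  have hc : 0 < (Fintype.card Ω : ℝ) := by exact_mod_cast Fintype.card_pos
  let p : ∀ i, γ i → ℝ := fun i a => ((Finset.univ.filter fun ω => f i ω = a).card : ℝ) /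
    Fintype.card Ω
  have hp : ∀ i ω, p i (f i ω) = ((fiber (f i) ω).card : ℝ) / Fintype.card Ω := by
    intro i ω
    simp only [p, fiber]
  have hpos : ∀ i ω, 0 < p i (f i ω) := fun i ω => by
    rw [hp]; exact div_pos (card_fiber_pos _ _) hc
  have hp1 : ∀ i, ∑ a ∈ Finset.univ.image (f i), p i a = 1 := by
    intro i
    have := Finset.card_eq_sum_card_image (f i) (Finset.univ : Finset Ω)
    simp only [p, ← Finset.sum_div]
    rw [div_eq_one_iff_eq hc.ne', ← Nat.cast_sum, ← this, Finset.card_univ]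
  refine (entropy_le_of_sum_le_one (fun ω i => f i ω) (fun a => ∏ i, p i (a i))
    (fun ω => Finset.prod_pos fun i _ => hpos i ω) ?_).trans ?_
  · calc _ ≤ ∑ a ∈ Fintype.piFinset fun i => Finset.univ.image (f i), ∏ i, p i (a i) := by
          refine Finset.sum_le_sum_of_subset_of_nonneg ?_ fun a _ _ =>
            Finset.prod_nonneg fun i _ => by positivity
          intro a ha
          obtain ⟨ω, -, rfl⟩ := Finset.mem_image.1 ha
          exact Fintype.mem_piFinset.2 fun i => Finset.mem_image_of_mem _ (Finset.mem_univ ω)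
      _ = 1 := by rw [← Finset.prod_univ_sum]; simp [hp1]
  · rw [div_le_iff₀ hc, Finset.sum_mul]
    refine le_of_eq ?_
    simp only [entropy, div_mul_cancel₀ _ hc.ne']
    rw [Finset.sum_comm]
    refine Finset.sum_congr rfl fun ω _ => ?_
    rw [Real.log_prod fun i _ => (hpos i ω).ne', ← Finset.sum_neg_distrib]
    refine Finset.sum_congr rfl fun i _ => ?_
    rw [hp, Real.log_div (card_fiber_pos _ _).ne' hc.ne']
    ring

theorem entropy_prod_le [Nonempty Ω] (f : Ω → α) (g : Ω → β) :
    entropy (fun ω => (f ω, g ω)) ≤ entropy f + entropy g := by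
  have h := entropy_pi_le fun b : Bool => cond b (fiber f) (fiber g)
  rw [Fintype.sum_bool] at h
  refine (entropy_mono fun ω ω' hω => ?_).trans (h.trans_eq ?_)
  · exact Prod.ext ((fiber_eq_iff (f := f)).1 (congrFun hω true))
      ((fiber_eq_iff (f := g)).1 (congrFun hω false))
  · exact congrArg₂ _ (entropy_congr fun _ _ => fiber_eq_iff.symm)
      (entropy_congr fun _ _ => fiber_eq_iff.symm)

/-- A uniform coordinate on which `f` does not depend adds its full entropy. -/
theorem entropy_coord_prod {ι A : Type*} [Fintype ι] [DecidableEq ι] [Fintype A] [Nonempty A]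
    (k : ι) (f : (ι → A) → β) (hf : ∀ W x, f (Function.update W k x) = f W) :
    entropy (fun W => (W k, f W)) = Real.log (Fintype.card A) + entropy f := by
  have hA : 0 < (Fintype.card A : ℝ) := by exact_mod_cast Fintype.card_pos
  have hc : 0 < (Fintype.card (ι → A) : ℝ) := by exact_mod_cast Fintype.card_pos
  have key : ∀ W, ((fiber f W).card : ℝ) =
      Fintype.card A * (fiber (fun W => (W k, f W)) W).card := by
    intro W
    rw [← Finset.card_univ]
    norm_cast
    rw [← Finset.card_product]
    refine Finset.card_bij' (fun V _ => (V k, Function.update V k (W k)))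
      (fun p _ => Function.update p.2 k p.1) ?_ ?_ ?_ ?_
    · intro V hV
      simpa [mem_fiber, hf] using hV
    · rintro ⟨x, V⟩ hV
      simp only [Finset.mem_product, mem_fiber, Prod.mk.injEq] at hV
      simp [mem_fiber, hf, hV.2.2]
    · intro V _
      simp
    · rintro ⟨x, V⟩ hV
      simp only [Finset.mem_product, mem_fiber, Prod.mk.injEq] at hV
      simp [← hV.2.1]
  unfold entropy
  rw [← sub_eq_iff_eq_add, ← sub_div, ← Finset.sum_sub_distrib, div_eq_iff hc.ne']
  have : ∀ W, Real.log (fiber f W).card =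
      Real.log (Fintype.card A) + Real.log (fiber (fun W => (W k, f W)) W).card := fun W => by
    rw [key, Real.log_mul hA.ne' (card_fiber_pos _ W).ne']
  simp only [this]
  simp [mul_comm]

end Entropy


variable {N K L : ℕ} {X Y F : Type*} {Q : Fin N → Type*}
  [Fintype X] [Fintype Y] [Fintype F] [Nonempty F] [∀ n, Fintype (Q n)]

/-! ### Averages over the key and privacy -/

theorem card_query_eq (c : PIRCode N K L X Y F Q) (k k' : Fin K) (n : Fin N) (q : Q n) :
    Nat.card {f : F // c.query n k f = q} = Nat.card {f : F // c.query n k' f = q} := by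
  have hF : (Fintype.card F : ℝ) ≠ 0 := by exact_mod_cast Fintype.card_ne_zero
  have h := c.privacy k k' n q
  rw [div_left_inj' hF] at h
  exact_mod_cast h

/-- A query used for one message is used for every message. -/
theorem exists_query_eq (c : PIRCode N K L X Y F Q) (k k' : Fin K) (n : Fin N) (f : F) :
    ∃ f', c.query n k' f' = c.query n k f := by
  have : Nonempty {f' : F // c.query n k f' = c.query n k f} := ⟨⟨f, rfl⟩⟩
  have h : 0 < Nat.card {f' : F // c.query n k f' = c.query n k f} := Nat.card_pos
  rw [c.card_query_eq k k' n] at h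
  obtain ⟨f', hf'⟩ := (Nat.card_pos_iff.1 h).1
  exact ⟨f', hf'⟩

theorem sum_query_eq_sum_card_mul (c : PIRCode N K L X Y F Q) (k : Fin K) (n : Fin N)
    (φ : Q n → ℝ) :
    ∑ f, φ (c.query n k f) = ∑ q, (Nat.card {f : F // c.query n k f = q} : ℝ) * φ q := by
  classical
  rw [← Finset.sum_fiberwise (s := Finset.univ) (g := c.query n k)]
  refine Finset.sum_congr rfl fun q _ => ?_
  rw [Finset.sum_congr rfl (g := fun _ => φ q), Finset.sum_const, nsmul_eq_mul,
    Nat.card_eq_fintype_card, Fintype.card_subtype]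
  intro f hf
  rw [(Finset.mem_filter.1 hf).2]

theorem sum_query_eq (c : PIRCode N K L X Y F Q) (k k' : Fin K) (n : Fin N) (φ : Q n → ℝ) :
    ∑ f, φ (c.query n k f) = ∑ f, φ (c.query n k' f) := by
  simp only [sum_query_eq_sum_card_mul, c.card_query_eq k k' n]

theorem sum_len_query (c : PIRCode N K L X Y F Q) (k : Fin K) (n : Fin N) :
    ∑ f, (c.len n (c.query n k f) : ℝ) = Fintype.card F * c.expectedLength k n := by
  have hF : (Fintype.card F : ℝ) ≠ 0 := by exact_mod_cast Fintype.card_ne_zero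
  rw [c.sum_query_eq_sum_card_mul k n fun q => (c.len n q : ℝ)]
  simp only [expectedLength, queryProb, Finset.mul_sum]
  refine Finset.sum_congr rfl fun q _ => ?_
  field_simp

theorem mul_geom_sum_one_div_succ (a x : ℝ) (t : ℕ) :
    a * ∑ i ∈ Finset.range (t + 1), (1 / x) ^ i =
      a + a * (∑ i ∈ Finset.range t, (1 / x) ^ i) / x := by
  rw [geom_sum_succ]
  ring

/-- The answers attain the converse bound in total. -/
theorem IsCapacityAchieving.log_mul_sum_len {c : PIRCode N K L X Y F Q}
    (h : c.IsCapacityAchieving) (hN : 1 ≤ N) (hK : 1 ≤ K) (k : Fin K) :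
    0 < L * Real.log (Fintype.card X) ∧
    Real.log (Fintype.card Y) * ∑ f, ∑ n, (c.len n (c.query n k f) : ℝ) =
      Fintype.card F * (L * Real.log (Fintype.card X)) *
        ∑ i ∈ Finset.range K, (1 / (N : ℝ)) ^ i := by
  have hN' : (0 : ℝ) < N := by exact_mod_cast hN
  have hS : 0 < ∑ i ∈ Finset.range K, (1 / (N : ℝ)) ^ i :=
    Finset.sum_pos (fun i _ => by positivity) ⟨0, Finset.mem_range.2 hK⟩
  have h2 : Real.log 2 ≠ 0 := (Real.log_pos one_lt_two).ne'
  have hk := h k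
  have hlen : ∑ f, ∑ n, (c.len n (c.query n k f) : ℝ) =
      Fintype.card F * ∑ n, c.expectedLength k n := by
    rw [Finset.sum_comm, Finset.mul_sum]
    exact Finset.sum_congr rfl fun n _ => c.sum_len_query k n
  have hr : c.rate k = (L * Real.log (Fintype.card X)) /
      (Real.log (Fintype.card Y) * ∑ n, c.expectedLength k n) := by
    simp only [rate, Real.logb]
    rw [← mul_div_assoc, div_mul_eq_mul_div, div_div_div_cancel_right₀ h2]
  rw [hr, capacity, ← one_div] at hk
  have hpos : 0 < 1 / ∑ i ∈ Finset.range K, (1 / (N : ℝ)) ^ i := by positivity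
  rw [← hk] at hpos
  -- The rate is nonzero, so neither its numerator nor its denominator vanishes.
  have hnum : L * Real.log (Fintype.card X) ≠ 0 := fun h0 => by simp [h0] at hpos
  have hden : Real.log (Fintype.card Y) * ∑ n, c.expectedLength k n ≠ 0 :=
    fun h0 => by simp [h0] at hpos
  have hM : 0 ≤ L * Real.log (Fintype.card X) :=
    mul_nonneg (Nat.cast_nonneg _) (Real.log_natCast_nonneg _)
  refine ⟨hM.lt_of_ne' hnum, ?_⟩
  rw [div_eq_div_iff hden hS.ne', one_mul] at hk
  rw [hlen, mul_assoc, hk]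
  ring

/-! ### Contributions of sets of messages to the answers -/

variable [AddCommGroup Y]

/-- A choice of the summands that witness decomposability. -/
structure Decomposition (c : PIRCode N K L X Y F Q) where
  /-- the contribution of a single message to a coordinate of an answer -/
  summand : (n : Fin N) → (q : Q n) → Fin (c.len n q) → Fin K → (Fin L → X) → Y
  answer_eq : ∀ n q W i, c.answer n q W i = ∑ k, summand n q i k (W k)

theorem IsDecomposable.nonempty_decomposition {c : PIRCode N K L X Y F Q}
    (h : c.IsDecomposable) : Nonempty c.Decomposition := by
  choose g hg using h
  exact ⟨⟨g, hg⟩⟩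

namespace Decomposition

variable {c : PIRCode N K L X Y F Q} (d : c.Decomposition)

/-- The contribution of the messages in `T` to the answer of server `n` to `q`. -/
def part (T : Finset (Fin K)) (n : Fin N) (q : Q n) (W : Fin K → Fin L → X) :
    Fin (c.len n q) → Y :=
  fun i => ∑ k ∈ T, d.summand n q i k (W k)

/-- The contributions of the messages in `T` to all answers, when message `k` is requested with
key `f`. -/
def parts (T : Finset (Fin K)) (k : Fin K) (f : F) (W : Fin K → Fin L → X) :
    (n : Fin N) → Fin (c.len n (c.query n k f)) → Y :=
  fun n => d.part T n (c.query n k f) W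

theorem part_univ (n : Fin N) (q : Q n) (W : Fin K → Fin L → X) :
    d.part Finset.univ n q W = c.answer n q W :=
  funext fun i => (d.answer_eq n q W i).symm

theorem part_congr {T : Finset (Fin K)} {W W' : Fin K → Fin L → X}
    (h : ∀ k ∈ T, W k = W' k) (n : Fin N) (q : Q n) : d.part T n q W = d.part T n q W' :=
  funext fun i => Finset.sum_congr rfl fun k hk => by rw [h k hk]

theorem part_union {S T : Finset (Fin K)} (h : Disjoint S T) (n : Fin N) (q : Q n)
    (W : Fin K → Fin L → X) : d.part (S ∪ T) n q W = d.part S n q W + d.part T n q W :=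
  funext fun _ => Finset.sum_union h

theorem part_add_part_erase {T : Finset (Fin K)} {k : Fin K} (hk : k ∈ T) (n : Fin N) (q : Q n)
    (W : Fin K → Fin L → X) :
    d.part {k} n q W + d.part (T.erase k) n q W = d.part T n q W := by
  rw [← d.part_union (by simp), ← Finset.insert_eq, Finset.insert_erase hk]

/-- Completing the messages outside `T` in any fixed way shows that the contributions of `T` alone
already determine a requested message in `T`. -/
theorem message_eq_of_parts_eq {T : Finset (Fin K)} {k : Fin K} (hk : k ∈ T) {f : F}
    {W W' : Fin K → Fin L → X} (h : d.parts T k f W = d.parts T k f W') : W k = W' k := by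
  have hV : ∀ n, c.answer n (c.query n k f) (T.piecewise W' W) =
      c.answer n (c.query n k f) W := by
    intro n
    rw [← d.part_univ, ← d.part_univ, ← Finset.union_compl T, d.part_union disjoint_compl_right,
      d.part_union disjoint_compl_right]
    congr 1
    · exact (d.part_congr (fun j hj => by simp [hj]) n _).trans (congrFun h n).symm
    · exact d.part_congr (fun j hj => by simp [Finset.mem_compl.1 hj]) n _
  have h1 := c.correct k f (T.piecewise W' W)
  simp only [hV, c.correct] at h1
  simpa [hk] using h1

/-! ### The entropy inequalities behind the capacity -/

/-- The entropy of the contribution of `T` to one answer. -/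
noncomputable def partEntropy (T : Finset (Fin K)) (n : Fin N) (q : Q n) : ℝ :=
  entropy (d.part T n q)

/-- The joint entropy of the contributions of `T` to all answers. -/
noncomputable def jointEntropy (T : Finset (Fin K)) (k : Fin K) (f : F) : ℝ :=
  entropy (d.parts T k f)

theorem partEntropy_le_jointEntropy (T : Finset (Fin K)) (k : Fin K) (f : F) (n : Fin N) :
    d.partEntropy T n (c.query n k f) ≤ d.jointEntropy T k f :=
  entropy_mono fun _ _ h => congrFun h n

theorem jointEntropy_le_sum [Nonempty X] (T : Finset (Fin K)) (k : Fin K) (f : F) :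
    d.jointEntropy T k f ≤ ∑ n, d.partEntropy T n (c.query n k f) :=
  entropy_pi_le fun n => d.part T n (c.query n k f)

/-- Adding an independent summand does not decrease the entropy: given the message `j`, the
contributions of `T` and of `T.erase j` determine each other. -/
theorem partEntropy_erase_le [Nonempty X] {T : Finset (Fin K)} {j : Fin K} (hj : j ∈ T)
    (n : Fin N) (q : Q n) : d.partEntropy (T.erase j) n q ≤ d.partEntropy T n q := by
  have h := entropy_coord_prod (A := Fin L → X) j (d.part (T.erase j) n q) fun W x =>
    d.part_congr (fun i hi => by simp [Finset.ne_of_mem_erase hi]) n q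
  have h0 := entropy_coord_prod (A := Fin L → X) (ι := Fin K) j (fun _ => ()) fun _ _ => rfl
  rw [entropy_const (f := fun _ : Fin K → Fin L → X => ()) fun _ _ => rfl, add_zero] at h0
  have h1 := entropy_prod_le (fun W : Fin K → Fin L → X => (W j, ())) (d.part T n q)
  have h2 : entropy (fun W => (W j, d.part (T.erase j) n q W)) ≤
      entropy (fun W => ((W j, ()), d.part T n q W)) := by
    refine entropy_mono fun W W' hW => ?_
    obtain ⟨hWj, hT⟩ := Prod.mk.inj hW
    have hWj := (Prod.mk.inj hWj).1
    rw [← d.part_add_part_erase hj, ← d.part_add_part_erase hj,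
      d.part_congr (T := {j}) (W := W) (W' := W') (by simpa using hWj)] at hT
    exact Prod.ext hWj (add_left_cancel hT)
  unfold partEntropy
  linarith

theorem partEntropy_le_len [Nonempty X] (T : Finset (Fin K)) (n : Fin N) (q : Q n) :
    d.partEntropy T n q ≤ c.len n q * Real.log (Fintype.card Y) := by
  refine (entropy_le_log_card _).trans ?_
  simp

/-- The requested message is recovered, and the interference of the others along with it. -/
theorem add_jointEntropy_erase_le [Nonempty X] {T : Finset (Fin K)} {k : Fin K} (hk : k ∈ T)
    (f : F) :
    L * Real.log (Fintype.card X) + d.jointEntropy (T.erase k) k f ≤ d.jointEntropy T k f := by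
  have h := entropy_coord_prod (A := Fin L → X) k (d.parts (T.erase k) k f) fun W x =>
    funext fun n => d.part_congr (fun j hj => by simp [Finset.ne_of_mem_erase hj]) n _
  rw [Fintype.card_fun, Fintype.card_fin, Nat.cast_pow, Real.log_pow] at h
  rw [jointEntropy, ← h]
  refine entropy_mono fun W W' hW => ?_
  have hk' := d.message_eq_of_parts_eq hk hW
  refine Prod.ext hk' (funext fun n => ?_)
  have hn : d.part T n _ W = d.part T n _ W' := congrFun hW n
  rw [← d.part_add_part_erase hk, ← d.part_add_part_erase hk,
    d.part_congr (T := {k}) (W := W) (W' := W') (by simpa using hk')] at hn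
  exact add_left_cancel hn

theorem sum_partEntropy_div_le [Nonempty X] (T : Finset (Fin K)) (k : Fin K) (f : F) :
    (∑ n, d.partEntropy T n (c.query n k f)) / N ≤ d.jointEntropy T k f := by
  rcases Nat.eq_zero_or_pos N with rfl | hN
  · simpa [jointEntropy] using entropy_nonneg (d.parts T k f)
  have hN' : (0 : ℝ) < N := by exact_mod_cast hN
  rw [div_le_iff₀ hN']
  refine (Finset.sum_le_sum fun n _ => d.partEntropy_le_jointEntropy T k f n).trans ?_
  simp [mul_comm]

/-! ### Tightness for capacity-achieving codes -/

/-- The total, over all keys and servers, of the entropies of the contributions of `T`, when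
message `k` is requested. -/
noncomputable def download (T : Finset (Fin K)) (k : Fin K) : ℝ :=
  ∑ f, ∑ n, d.partEntropy T n (c.query n k f)

theorem download_eq (T : Finset (Fin K)) (k k' : Fin K) : d.download T k = d.download T k' := by
  unfold download
  rw [Finset.sum_comm, Finset.sum_comm (s := (Finset.univ : Finset F))]
  exact Finset.sum_congr rfl fun n _ => c.sum_query_eq k k' n (d.partEntropy T n)

theorem add_sum_div_le [Nonempty X] {T : Finset (Fin K)} {k : Fin K} (hk : k ∈ T) (f : F) :
    L * Real.log (Fintype.card X) + (∑ n, d.partEntropy (T.erase k) n (c.query n k f)) / N ≤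
      ∑ n, d.partEntropy T n (c.query n k f) := by
  have h1 := d.sum_partEntropy_div_le (T.erase k) k f
  have h2 := d.add_jointEntropy_erase_le hk f
  have h3 := d.jointEntropy_le_sum T k f
  linarith

theorem add_download_div_le [Nonempty X] {T : Finset (Fin K)} {k : Fin K} (hk : k ∈ T)
    (k' : Fin K) :
    Fintype.card F * (L * Real.log (Fintype.card X)) + d.download (T.erase k) k' / N ≤
      d.download T k' := by
  rw [d.download_eq _ k' k, d.download_eq _ k' k]
  refine le_trans (le_of_eq ?_) (Finset.sum_le_sum fun f _ => d.add_sum_div_le hk f)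
  rw [Finset.sum_add_distrib, download, Finset.sum_div]
  simp

/-- The converse bound for the messages in `T` only. -/
theorem le_download [Nonempty X] (T : Finset (Fin K)) (k : Fin K) :
    Fintype.card F * (L * Real.log (Fintype.card X)) *
      ∑ i ∈ Finset.range T.card, (1 / (N : ℝ)) ^ i ≤ d.download T k := by
  induction T using Finset.induction_on with
  | empty =>
    simp only [Finset.card_empty, Finset.range_zero, Finset.sum_empty, mul_zero]
    exact Finset.sum_nonneg fun f _ => Finset.sum_nonneg fun n _ => entropy_nonneg _
  | insert j T hj ih =>
    have h := d.add_download_div_le (Finset.mem_insert_self j T) k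
    rw [Finset.erase_insert hj] at h
    refine le_trans ?_ h
    rw [Finset.card_insert_of_notMem hj, mul_geom_sum_one_div_succ]
    gcongr

/-- In a capacity-achieving code the bound for all messages is attained, and attainment passes
down to every set of messages. -/
theorem download_le [Nonempty X] (hN : 1 ≤ N)
    (hlen : Real.log (Fintype.card Y) * ∑ f, ∑ n, (c.len n (c.query n k f) : ℝ) =
      Fintype.card F * (L * Real.log (Fintype.card X)) *
        ∑ i ∈ Finset.range K, (1 / (N : ℝ)) ^ i) (T : Finset (Fin K)) :
    d.download T k ≤ Fintype.card F * (L * Real.log (Fintype.card X)) *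
      ∑ i ∈ Finset.range T.card, (1 / (N : ℝ)) ^ i := by
  have hN' : (0 : ℝ) < N := by exact_mod_cast hN
  induction hm : Tᶜ.card generalizing T with
  | zero =>
    obtain rfl : T = Finset.univ := by simpa using hm
    rw [Finset.card_univ, Fintype.card_fin, ← hlen, Finset.mul_sum]
    refine Finset.sum_le_sum fun f _ => ?_
    rw [Finset.mul_sum]
    refine Finset.sum_le_sum fun n _ => ?_
    rw [mul_comm]
    exact d.partEntropy_le_len _ n _
  | succ m ih =>
    obtain ⟨j, hj⟩ : Tᶜ.Nonempty := Finset.card_pos.1 (by omega)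
    have hjT := Finset.mem_compl.1 hj
    have h1 := ih (insert j T) (by
      rw [Finset.compl_insert, Finset.card_erase_of_mem hj, hm, Nat.add_sub_cancel])
    have h2 := d.add_download_div_le (Finset.mem_insert_self j T) k
    rw [Finset.erase_insert hjT] at h2
    rw [Finset.card_insert_of_notMem hjT, mul_geom_sum_one_div_succ] at h1
    have h3 := h2.trans h1
    rw [add_le_add_iff_left] at h3
    exact (div_le_div_iff_of_pos_right hN').1 h3

/-- In a capacity-achieving code the inequality `add_sum_div_le` is an equality for each key, since
it is one after summation over the keys. -/
theorem sum_partEntropy_eq [Nonempty X] (h : c.IsCapacityAchieving) (hN : 1 ≤ N) (hK : 1 ≤ K)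
    {T : Finset (Fin K)} {k : Fin K} (hk : k ∈ T) (f : F) :
    L * Real.log (Fintype.card X) + (∑ n, d.partEntropy (T.erase k) n (c.query n k f)) / N =
      ∑ n, d.partEntropy T n (c.query n k f) := by
  refine (Finset.sum_eq_sum_iff_of_le fun f _ => d.add_sum_div_le hk f).1 ?_ f (Finset.mem_univ f)
  have hlen := (h.log_mul_sum_len hN hK k).2
  have h1 := d.download_le hN hlen T
  have h2 := d.le_download (T.erase k) k
  rw [← Finset.insert_erase hk, Finset.card_insert_of_notMem (Finset.notMem_erase k T),
    mul_geom_sum_one_div_succ, Finset.insert_erase hk] at h1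
  have h3 := d.add_download_div_le hk k
  have h4 := div_le_div_of_nonneg_right h2 (Nat.cast_nonneg (α := ℝ) N)
  rw [Finset.sum_add_distrib, ← Finset.sum_div]
  change _ + d.download (T.erase k) k / N = d.download T k
  simp only [Finset.sum_const, Finset.card_univ, nsmul_eq_mul]
  linarith

theorem sum_partEntropy_eq_add_jointEntropy [Nonempty X] (h : c.IsCapacityAchieving) (hN : 1 ≤ N)
    (hK : 1 ≤ K) {T : Finset (Fin K)} {k : Fin K} (hk : k ∈ T) (f : F) :
    ∑ n, d.partEntropy T n (c.query n k f) =
      L * Real.log (Fintype.card X) + d.jointEntropy (T.erase k) k f := by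
  have h1 := d.sum_partEntropy_div_le (T.erase k) k f
  have h2 := d.add_jointEntropy_erase_le hk f
  have h3 := d.jointEntropy_le_sum T k f
  have h4 := d.sum_partEntropy_eq h hN hK hk f
  linarith

/-- The interference in each answer determines the interference in all answers. -/
theorem partEntropy_eq_jointEntropy [Nonempty X] (h : c.IsCapacityAchieving) (hN : 1 ≤ N)
    (hK : 1 ≤ K) {T : Finset (Fin K)} {k : Fin K} (hk : k ∉ T) (f : F) (n : Fin N) :
    d.partEntropy T n (c.query n k f) = d.jointEntropy T k f := by
  have hN' : (0 : ℝ) < N := by exact_mod_cast hN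
  refine (Finset.sum_eq_sum_iff_of_le fun n _ => d.partEntropy_le_jointEntropy T k f n).1 ?_ n
    (Finset.mem_univ n)
  have h1 := d.sum_partEntropy_eq h hN hK (Finset.mem_insert_self k T) f
  have h2 := d.sum_partEntropy_eq_add_jointEntropy h hN hK (Finset.mem_insert_self k T) f
  rw [Finset.erase_insert hk] at h1 h2
  have h3 : (∑ n, d.partEntropy T n (c.query n k f)) / N = d.jointEntropy T k f := by linarith
  rw [div_eq_iff hN'.ne'] at h3
  rw [h3]
  simp [mul_comm]

/-! ### Signatures of queries -/

/-- The information on message `j` in the answer of server `n` to `q`, once the other messages are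
known: the partition of the message tuples given by the contribution of `j`. -/
def signature (n : Fin N) (q : Q n) (j : Fin K) : Setoid (Fin K → Fin L → X) :=
  Setoid.ker (d.part {j} n q)

theorem signature_eq_top_iff [Nonempty X] {n : Fin N} {q : Q n} {j : Fin K} :
    d.signature n q j = ⊤ ↔ d.partEntropy {j} n q = 0 := by
  refine ⟨fun h => entropy_const fun W W' => ?_, fun h => ?_⟩
  · have : d.signature n q j W W' := by rw [h]; trivial
    exact this
  · exact Setoid.eq_top_iff.2 fun W W' => eq_of_entropy_eq_zero h W W'

theorem signature_eq_of_ne [Nonempty X] (h : c.IsCapacityAchieving) (hN : 1 ≤ N) (hK : 1 ≤ K)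
    {k j : Fin K} (hjk : j ≠ k) (f : F) (n m : Fin N) :
    d.signature n (c.query n k f) j = d.signature m (c.query m k f) j := by
  have key : ∀ n, d.signature n (c.query n k f) j = Setoid.ker (d.parts {j} k f) := by
    intro n
    ext W W'
    refine ⟨fun hW => ?_, fun hW => congrFun hW n⟩
    exact eq_of_entropy_eq (f := d.part {j} n (c.query n k f)) (fun _ _ h => congrFun h n)
      (d.partEntropy_eq_jointEntropy h hN hK (by simpa using hjk.symm) f n) hW
  rw [key, key]

/-- If two answers carried the same information on the requested message, one of them could be
dropped, so by tightness both contributions would be constant. The corresponding two answers would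
then consist of the interference of message `z` only, which is more than tightness allows. -/
theorem signature_requested_ne [Nonempty X] (h : c.IsCapacityAchieving) (hN : 1 ≤ N) (hK : 1 ≤ K)
    {k z : Fin K} (hzk : z ≠ k) (f : F) {n m : Fin N} (hnm : n ≠ m)
    (hz : d.signature n (c.query n k f) z ≠ ⊤) :
    d.signature n (c.query n k f) k ≠ d.signature m (c.query m k f) k := by
  intro heq
  have hsum := d.sum_partEntropy_eq_add_jointEntropy h hN hK (Finset.mem_singleton_self k) f
  have hle := d.add_jointEntropy_erase_le (Finset.mem_singleton_self k) f
  -- Every answer but that of server `m` suffices for the contribution of `k`.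
  have hdrop : d.jointEntropy {k} k f ≤
      ∑ i : {i // i ≠ m}, d.partEntropy {k} i (c.query i k f) := by
    refine (entropy_mono fun W W' hW => ?_).trans
      (entropy_pi_le fun i : {i // i ≠ m} => d.part {k} i (c.query i k f))
    refine funext fun i => ?_
    by_cases him : i = m
    · subst him
      have : d.signature n (c.query n k f) k W W' := congrFun hW ⟨n, hnm⟩
      rw [heq] at this
      exact this
    · exact congrFun hW ⟨i, him⟩
  have hsplit := Fintype.sum_eq_add_sum_subtype_ne
    (fun i => d.partEntropy {k} i (c.query i k f)) m
  have hm : d.partEntropy {k} m (c.query m k f) = 0 :=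
    le_antisymm (by linarith) (entropy_nonneg _)
  have hn : d.partEntropy {k} n (c.query n k f) = 0 := by
    rw [← d.signature_eq_top_iff] at hm ⊢
    rw [heq, hm]
  set a := d.jointEntropy {z} k f
  have ha : ∀ i, d.partEntropy {z} i (c.query i k f) = a := fun i =>
    d.partEntropy_eq_jointEntropy h hN hK (by simpa using hzk.symm) f i
  have ha0 : 0 < a := by
    rw [Ne, d.signature_eq_top_iff, ha] at hz
    exact (entropy_nonneg _).lt_of_ne' hz
  have hez : ({k, z} : Finset (Fin K)).erase z = {k} := by
    ext i; simp; grind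
  have hek : ({k, z} : Finset (Fin K)).erase k = {z} := by
    ext i; simp; grind
  have hsum2 := d.sum_partEntropy_eq_add_jointEntropy h hN hK
    (show k ∈ ({k, z} : Finset (Fin K)) by simp) f
  rw [hek] at hsum2
  have hlek : ∀ i, d.partEntropy {k} i (c.query i k f) ≤
      d.partEntropy {k, z} i (c.query i k f) := fun i => by
    have := d.partEntropy_erase_le (show z ∈ ({k, z} : Finset (Fin K)) by simp) i (c.query i k f)
    rwa [hez] at this
  have hlez : ∀ i, a ≤ d.partEntropy {k, z} i (c.query i k f) := fun i => by
    have := d.partEntropy_erase_le (show k ∈ ({k, z} : Finset (Fin K)) by simp) i (c.query i k f)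
    rwa [hek, ha] at this
  have h2 : ∑ i, d.partEntropy {k} i (c.query i k f) + (a + a) ≤
      ∑ i, d.partEntropy {k, z} i (c.query i k f) := by
    have hpair := Finset.sum_le_sum_of_subset_of_nonneg (Finset.subset_univ ({n, m} : Finset _))
      fun i _ _ => sub_nonneg.2 (hlek i)
    rw [Finset.sum_pair hnm, Finset.sum_sub_distrib, hn, hm] at hpair
    linarith [hlez n, hlez m]
  have hj0 : d.jointEntropy (({k} : Finset (Fin K)).erase k) k f ≥ 0 := entropy_nonneg _
  linarith

/-- Requesting the messages of `S` one after the other, each time keeping a query of the preceding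
step, reaches `N ^ |S|` signatures. The message `z` is never requested, so its contribution keeps
the signatures at each step apart. -/
theorem exists_signatures [Nonempty X] (h : c.IsCapacityAchieving) (hN : 1 ≤ N) (hK : 1 ≤ K)
    {z : Fin K} (S : Finset (Fin K)) (hzS : z ∉ S) (n : Fin N) (f : F)
    (hz : d.signature n (c.query n z f) z ≠ ⊤) :
    ∃ A : Finset (Fin K → Setoid (Fin K → Fin L → X)), N ^ S.card ≤ A.card ∧
      ∀ σ ∈ A, (∃ m g, σ = d.signature m (c.query m z g)) ∧
        ∀ j ∉ S, σ j = d.signature n (c.query n z f) j := by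
  classical
  induction S using Finset.induction_on generalizing n f with
  | empty =>
    exact ⟨{d.signature n (c.query n z f)}, by simp, by simpa using ⟨n, f, rfl⟩⟩
  | insert k S hkS ih =>
    have hzk : z ≠ k := fun e => hzS (e ▸ Finset.mem_insert_self _ _)
    have hzS' : z ∉ S := fun e => hzS (Finset.mem_insert_of_mem e)
    obtain ⟨g, hg⟩ := c.exists_query_eq z k n f
    choose f' hf' using fun m => c.exists_query_eq k z m g
    have hsame : ∀ m, ∀ j ≠ k, d.signature m (c.query m z (f' m)) j =
        d.signature n (c.query n z f) j := fun m j hj => by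
      rw [hf', ← hg]
      exact d.signature_eq_of_ne h hN hK hj g m n
    choose A hcard hA using fun m => ih hzS' m (f' m) (by rwa [hsame m z hzk])
    refine ⟨Finset.univ.biUnion A, ?_, ?_⟩
    · rw [Finset.card_biUnion]
      · refine le_trans (le_of_eq ?_) (Finset.sum_le_sum fun m _ => hcard m)
        simp [Finset.card_insert_of_notMem hkS, pow_succ']
      · intro m _ m' _ hmm
        refine Finset.disjoint_left.2 fun σ hσ hσ' => ?_
        have e := ((hA m σ hσ).2 k hkS).symm.trans ((hA m' σ hσ').2 k hkS)
        rw [hf', hf'] at e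
        refine d.signature_requested_ne h hN hK hzk g hmm ?_ e
        rwa [← hf', hsame m z hzk]
    · intro σ hσ
      obtain ⟨m, -, hm⟩ := Finset.mem_biUnion.1 hσ
      refine ⟨(hA m σ hm).1, fun j hj => ?_⟩
      rw [Finset.mem_insert, not_or] at hj
      rw [(hA m σ hm).2 j hj.2, hsame m j hj.1]

end Decomposition

theorem IsCapacityAchieving.pow_le_card_query [Nonempty X] {c : PIRCode N K L X Y F Q}
    (h : c.IsCapacityAchieving) (hdec : c.IsDecomposable) (hN : 1 ≤ N) (hK : 1 ≤ K) (s : Fin N) :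
    N ^ (K - 1) ≤ Fintype.card (Q s) := by
  classical
  obtain ⟨d⟩ := hdec.nonempty_decomposition
  let z : Fin K := ⟨0, hK⟩
  obtain ⟨f⟩ := ‹Nonempty F›
  -- Some answer depends on the requested message.
  obtain ⟨n, hn⟩ : ∃ n, d.signature n (c.query n z f) z ≠ ⊤ := by
    by_contra! hall
    have hsum := d.sum_partEntropy_eq_add_jointEntropy h hN hK (Finset.mem_singleton_self z) f
    rw [Finset.sum_eq_zero fun n _ => d.signature_eq_top_iff.1 (hall n)] at hsum
    have hM := (h.log_mul_sum_len hN hK z).1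
    have hJ : 0 ≤ d.jointEntropy (({z} : Finset (Fin K)).erase z) z f := entropy_nonneg _
    linarith
  obtain ⟨A, hcard, hA⟩ :=
    d.exists_signatures h hN hK (Finset.univ.erase z) (Finset.notMem_erase _ _) n f hn
  rw [Finset.card_erase_of_mem (Finset.mem_univ z), Finset.card_univ, Fintype.card_fin] at hcard
  -- Requesting `z` moves every signature to server `s`, up to its value at `z`.
  have hsub : A ⊆ Finset.univ.image fun q : Q s =>
      Function.update (d.signature s q) z (d.signature n (c.query n z f) z) := by
    intro σ hσ
    obtain ⟨⟨m, g, rfl⟩, hoff⟩ := hA σ hσ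
    refine Finset.mem_image.2 ⟨c.query s z g, Finset.mem_univ _, funext fun j => ?_⟩
    by_cases hj : j = z
    · subst hj
      rw [Function.update_self, hoff _ (Finset.notMem_erase _ _)]
    · rw [Function.update_of_ne hj]
      exact d.signature_eq_of_ne h hN hK hj g s m
  exact hcard.trans ((Finset.card_le_card hsub).trans
    (Finset.card_image_le.trans_eq Finset.card_univ))

end PIRCode

theorem theorem4 {N K L : ℕ} (hN : 1 ≤ N) (hK : 1 ≤ K)
    {X Y F : Type*} {Q : Fin N → Type*}
    [Fintype X] [Fintype Y] [AddCommGroup Y] [Fintype F] [Nonempty F] [∀ n, Fintype (Q n)]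
    (c : PIRCode N K L X Y F Q)
    (hdec : c.IsDecomposable) (hcap : c.IsCapacityAchieving) :
    (N : ℝ) * ((K : ℝ) - 1) * Real.logb 2 (N : ℝ) ≤ c.uploadCost ∧
      ∀ n : Fin N, N ^ (K - 1) ≤ Fintype.card (Q n) := by
  have hM := (hcap.log_mul_sum_len hN hK ⟨0, hK⟩).1
  have : Nonempty X := by
    -- For empty `X` the messages would carry `log 0 = 0` nats.
    by_contra hX
    rw [not_nonempty_iff] at hX
    simp at hM
  have hQ := hcap.pow_le_card_query hdec hN hK
  refine ⟨?_, hQ⟩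
  have hN' : (0 : ℝ) < N := by exact_mod_cast hN
  have hlog : ∀ n, ((K : ℝ) - 1) * Real.logb 2 N ≤ Real.logb 2 (Fintype.card (Q n)) := by
    intro n
    rw [← Nat.cast_one, ← Nat.cast_sub hK, ← Real.logb_pow]
    refine Real.logb_le_logb_of_le one_lt_two (by positivity) ?_
    exact_mod_cast hQ n
  calc (N : ℝ) * ((K : ℝ) - 1) * Real.logb 2 (N : ℝ)
      = ∑ _n : Fin N, ((K : ℝ) - 1) * Real.logb 2 N := by simp [mul_assoc]
    _ ≤ c.uploadCost := Finset.sum_le_sum fun n _ => hlog n
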